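/- Let $(V,\omega)$ be a real symplectic vector space of dimension $2n$, and let $\Lambda$ be its Lagrangian Grassmannian, i.e. the set of all $n$-dimensional subspaces of $V$ on which $\omega$ vanishes identically. For transverse Lagrangians $L_0,L_1\in\Lambda$ (so $V=L_0\oplus L_1$) let $\Lambda^0(L_1)=\{L\in\Lambda: L\cap L_1=\{0\}\}$ and, for $L\in\Lambda^0(L_1)$, let $\varphi_{L_0,L_1}(L)=\omega(T\cdot,\cdot)|_{L_0\times L_0}$, where $T:L_0\to L_1$ is the linear map whose graph in $L_0\oplus L_1=V$ is $L$; this is a symmetric bilinear form on $L_0$. The set $\Lambda$ carries the manifold topology defined by the charts $\varphi_{L_0,L_1}$. For a symmetric bilinear form $B$, let $n_+(B)$ be the maximal dimension of a subspace on which $B$ is positive definite. For every $L_0\in\Lambda$ there is exactly one integer valued function $\mu_{L_0}$ of continuous paths $\ell:[a,b]\to\Lambda$ ($a\le b$ arbitrary), called the $L_0$-Maslov index, such that: (a) $\mu_{L_0}$ is invariant under fixed-endpoint homotopies; (b) $\mu_{L_0}$ is additive by concatenation; (c) $\mu_{L_0}(\ell)=n_+\big[\varphi_{L_0,L_1}(\ell(b))\big]-n_+\big[\varphi_{L_0,L_1}(\ell(a))\big]$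 whenever $L_1$ is a Lagrangian transverse to $L_0$ and $\ell([a,b])\subset\Lambda^0(L_1)$. Moreover, for every continuous path $\ell:[a,b]\to\Lambda$ and all $L_0,L_1\in\Lambda$, $$\big|\mu_{L_0}(\ell)-\mu_{L_1}(\ell)\big|\le n-\dim(L_0\cap L_1).$$ -/

import Mathlib

noncomputable section

/-- The Lagrangian Grassmannian of `(V, ω)`: its points are the Lagrangian subspaces of `V`,
that is, the isotropic subspaces of half the dimension of `V`. -/
structure Lagrangian {V : Type*} [AddCommGroup V] [Module ℝ V]
    (ω : LinearMap.BilinForm ℝ V) where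
  /-- The underlying subspace. -/
  space : Submodule ℝ V
  isotropic : ∀ x ∈ space, ∀ y ∈ space, ω x y = 0
  two_mul_finrank : 2 * Module.finrank ℝ space = Module.finrank ℝ V

namespace Lagrangian

variable {V : Type*} [AddCommGroup V] [Module ℝ V] {ω : LinearMap.BilinForm ℝ V}

/-- Two Lagrangians are transverse if `V` is their direct sum. -/
abbrev Transverse (L L' : Lagrangian ω) : Prop := IsCompl L.space L'.space

/-- For `L₀` and `L` both transverse to `L₁`, the linear map `T : L₀ → L₁` whose graph in
`L₀ ⊕ L₁ = V` is `L`: it sends `x` to minus the component of `x` in `L₁` with respect to the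
decomposition `V = L₁ ⊕ L`. See `mem_iff_graphMap` for the characterization as a graph. -/
def graphMap (L₀ L₁ L : Lagrangian ω) (h : L.Transverse L₁) : L₀.space →ₗ[ℝ] L₁.space :=
  -((L₁.space.projectionOnto L.space h.symm) ∘ₗ L₀.space.subtype)

theorem add_graphMap_mem (L₀ L₁ L : Lagrangian ω) (h : L.Transverse L₁) (x : L₀.space) :
    (x : V) + (L₀.graphMap L₁ L h x : V) ∈ L.space := by
  have key := Submodule.projection_add_projection_eq_self h.symm (x : V)
  have : (x : V) + (L₀.graphMap L₁ L h x : V) = L.space.projection L₁.space h (x : V) := by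
    rw [eq_comm, ← sub_eq_iff_eq_add']
    simp only [graphMap, LinearMap.neg_apply, LinearMap.comp_apply, Submodule.subtype_apply,
      Submodule.coe_neg, Submodule.coe_projectionOnto_apply]
    rw [eq_neg_iff_add_eq_zero, sub_add_eq_add_sub, add_comm, key, sub_self]
  rw [this, ← Submodule.coe_projectionOnto_apply]
  exact Subtype.coe_prop _

/-- `L` is the graph of `graphMap`. -/
theorem mem_iff_graphMap (L₀ L₁ L : Lagrangian ω) (h₀ : L₀.Transverse L₁) (h : L.Transverse L₁)
    (v : V) : v ∈ L.space ↔ ∃ x : L₀.space, v = (x : V) + (L₀.graphMap L₁ L h x : V) := by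
  constructor
  · intro hv
    obtain ⟨x, y, hx, hy, rfl⟩ := Submodule.codisjoint_iff_exists_add_eq.1 h₀.codisjoint v
    refine ⟨⟨x, hx⟩, ?_⟩
    have h1 : L₁.space.projection L.space h.symm (x + y) = 0 :=
      Submodule.projection_apply_eq_zero_iff _ |>.2 hv
    have h2 : L₁.space.projection L.space h.symm y = y :=
      Submodule.projection_apply_of_mem_left _ hy
    rw [map_add, h2] at h1
    simp only [graphMap, LinearMap.neg_apply, LinearMap.comp_apply, Submodule.subtype_apply,
      Submodule.coe_neg, Submodule.coe_projectionOnto_apply]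
    rw [eq_neg_of_add_eq_zero_right h1]
  · rintro ⟨x, rfl⟩
    exact add_graphMap_mem L₀ L₁ L h x

/-- The chart `φ_{L₀,L₁}` at a Lagrangian `L` transverse to `L₁`: the (symmetric) bilinear form
`(x, y) ↦ ω (T x, y)` on `L₀`, where `T : L₀ → L₁` is the linear map with graph `L`. -/
def chart (L₀ L₁ L : Lagrangian ω) (h : L.Transverse L₁) : LinearMap.BilinForm ℝ L₀.space :=
  ω.compl₁₂ (L₁.space.subtype ∘ₗ L₀.graphMap L₁ L h) L₀.space.subtype

/-- The coindex `n₊(φ_{L₀,L₁}(L))`: the maximal dimension of a subspace of `L₀` on which the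
bilinear form `φ_{L₀,L₁}(L)` is positive definite. -/
def chartCoindex (L₀ L₁ L : Lagrangian ω) (h : L.Transverse L₁) : ℕ :=
  sigPos (LinearMap.BilinMap.toQuadraticMap (L₀.chart L₁ L h))

/-- The topology of pointwise convergence on bilinear forms; on a finite dimensional space this is
the usual topology of the vector space of bilinear forms. -/
@[reducible] def bilinFormTopology (W : Type*) [AddCommGroup W] [Module ℝ W] :
    TopologicalSpace (LinearMap.BilinForm ℝ W) :=
  TopologicalSpace.induced (fun B (x y : W) => B x y) inferInstance

/-- The manifold topology of the Lagrangian Grassmannian, generated by the inverse images of open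
sets under the charts `φ_{L₀,L₁} : {L | L transverse to L₁} → B_sym(L₀)`, where `(L₀, L₁)` runs
over the pairs of transverse Lagrangians. -/
instance instTopologicalSpace : TopologicalSpace (Lagrangian ω) :=
  TopologicalSpace.generateFrom
    {U | ∃ L₀ L₁ : Lagrangian ω, L₀.Transverse L₁ ∧
      ∃ O : Set (LinearMap.BilinForm ℝ L₀.space), @IsOpen _ (bilinFormTopology L₀.space) O ∧
        U = {L | ∃ h : L.Transverse L₁, L₀.chart L₁ L h ∈ O}}

end Lagrangian

/-- Integer valued functions of a continuous path `ℓ : [a, b] → Λ`, for arbitrary `a ≤ b`. -/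
abbrev LagrangianPathFunction {V : Type*} [AddCommGroup V] [Module ℝ V]
    (ω : LinearMap.BilinForm ℝ V) : Type _ :=
  ∀ a b : ℝ, a ≤ b → C(Set.Icc a b, Lagrangian ω) → ℤ

/-- The restriction of a path on `[a, b]` to a subinterval `[c, d]`. -/
def restrictPath {X : Type*} [TopologicalSpace X] {a b : ℝ} (ℓ : C(Set.Icc a b, X)) (c d : ℝ)
    (hc : a ≤ c) (hd : d ≤ b) : C(Set.Icc c d, X) :=
  ℓ.comp ⟨Set.inclusion (Set.Icc_subset_Icc hc hd), continuous_inclusion _⟩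

/-- The properties characterizing the `L₀`-Maslov index. -/
structure IsMaslovIndex {V : Type*} [AddCommGroup V] [Module ℝ V]
    (ω : LinearMap.BilinForm ℝ V) (L₀ : Lagrangian ω) (μ : LagrangianPathFunction ω) : Prop where
  /-- Invariance under fixed-endpoint homotopies. -/
  homotopy : ∀ (a b : ℝ) (hab : a ≤ b) (ℓ ℓ' : C(Set.Icc a b, Lagrangian ω)),
    ContinuousMap.HomotopicRel ℓ ℓ'
      {⟨a, Set.left_mem_Icc.2 hab⟩, ⟨b, Set.right_mem_Icc.2 hab⟩} →
    μ a b hab ℓ = μ a b hab ℓ'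
  /-- Additivity by concatenation. -/
  concat : ∀ (a b c : ℝ) (hab : a ≤ b) (hbc : b ≤ c) (ℓ : C(Set.Icc a c, Lagrangian ω)),
    μ a c (hab.trans hbc) ℓ =
      μ a b hab (restrictPath ℓ a b le_rfl hbc) + μ b c hbc (restrictPath ℓ b c hab le_rfl)
  /-- The value on paths contained in the domain of a chart `φ_{L₀,L₁}`. -/
  chart : ∀ (a b : ℝ) (hab : a ≤ b) (ℓ : C(Set.Icc a b, Lagrangian ω)) (L₁ : Lagrangian ω),
    L₀.Transverse L₁ → ∀ h : ∀ t, (ℓ t).Transverse L₁,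
    μ a b hab ℓ =
      (L₀.chartCoindex L₁ (ℓ ⟨b, Set.right_mem_Icc.2 hab⟩) (h _) : ℤ) -
        (L₀.chartCoindex L₁ (ℓ ⟨a, Set.left_mem_Icc.2 hab⟩) (h _) : ℤ)

/-- The `L₀`-Maslov index: the integer valued function of continuous paths in the Lagrangian
Grassmannian that is characterized by `IsMaslovIndex`. -/
def maslovIndex {V : Type*} [AddCommGroup V] [Module ℝ V]
    (ω : LinearMap.BilinForm ℝ V) (L₀ : Lagrangian ω) : LagrangianPathFunction ω :=
  haveI : Nonempty (LagrangianPathFunction ω) := ⟨fun _ _ _ _ => 0⟩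
  Classical.epsilon (IsMaslovIndex ω L₀)

end

/-!
# The Maslov index of paths of Lagrangians

For complementary Lagrangians `A` and `Y`, consider on `V = A ⊕ Y` the quadratic form
`splitForm ω A Y : a + y ↦ ω (y, a)`, and let `k(X; A, Y)` (`relCoindex`) be the positive index of
its restriction to `X`. The coindex of the chart `φ_{X,A}(Y)` is `k(X; A, Y)`.

Everything rests on the exchange identity (`Lagrangian.relCoindex_add_relCoindex`)
`k(X; A, Y) + k(A; X, A') = k(X; A', Y) + k(A; Y, A')`
for `X`, `Y` both transverse to `A`, `A'`. One quadratic form on `V` is split orthogonally both by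
`V = X ⊕ A` and by `V = Y ⊕ A'`, and the two sides are its positive index.

*Existence and uniqueness.* Fix `X = L₀`. The functions `k(L₀; A, ·)` on the chart domains
`Λ⁰(A)` are not continuous, but by the exchange identity the difference of two of them is, up to a
constant, `Y ↦ k(A; Y, A')`: the positive index of a form on `A` that depends continuously on `Y`
and has the constant kernel `A ∩ A'`. So the difference is locally constant
(`Lagrangian.eventually_relCoindex_sub_eq`), hence is the transition function of a covering space
of `Λ` with fiber `ℤ`. Lifting paths to this covering space yields, along every path `ℓ`, a
function `g` that differs from each `k(L₀; A, ℓ(·))` by a locally constant function, and the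
Maslov index is `g(b) - g(a)`. Homotopy invariance is the monodromy theorem. The chart and
concatenation axioms determine the increments of `g`, which gives uniqueness.

*Comparison.* For `A` transverse to `L₀`, `L₁` and `L`, the exchange identity says that
`k(L₀; A, L) - k(L₁; A, L) - k(L₀; A, L₁)` does not depend on `A` (`Lagrangian.hormanderIndex_eq`).
As a function of `L = ℓ(t)` it is, up to a constant, the difference of the potentials for `L₀` and
`L₁`. It equals `n₊(B) - n₊(B - S) - n₊(S)` for two forms on `L₀`, the kernel of `S` being
`L₀ ∩ L₁`, so it lies between `-(n - dim (L₀ ∩ L₁))` and `0`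
(`Lagrangian.hormanderIndex_bounds`), and its increments have at most the stated size.
-/

/-! ### The positive index of inertia of real quadratic forms -/

namespace QuadraticForm

open Filter Topology

variable {M N : Type*} [AddCommGroup M] [Module ℝ M] [AddCommGroup N] [Module ℝ N]

theorem sigPos_eq_of_linearEquiv {Q : QuadraticForm ℝ M} {Q' : QuadraticForm ℝ N}
    (e : M ≃ₗ[ℝ] N) (h : ∀ x, Q' (e x) = Q x) : sigPos Q = sigPos Q' :=
  QuadraticMap.Equivalent.sigPos_eq ⟨{ e with map_app' := h }⟩

variable [FiniteDimensional ℝ M]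

/-- The dual description of `sigPos`: its codimension is attained by a negative semidefinite
subspace, namely the sum of a maximal negative definite subspace and the radical. -/
theorem exists_nonpos_finrank_add_sigPos (Q : QuadraticForm ℝ M) :
    ∃ W : Submodule ℝ M, (∀ x ∈ W, Q x ≤ 0) ∧
      Module.finrank ℝ W + sigPos Q = Module.finrank ℝ M := by
  obtain ⟨P, hP, hneg⟩ := exists_finrank_eq_sigNeg_and_negDef Q
  have hle : ∀ x ∈ P, x ≠ 0 → Q x < 0 := fun x hx h0 => by
    simpa using hneg ⟨x, hx⟩ (by simpa using h0)
  have hdisj : P ⊓ Q.radical = ⊥ := by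
    rw [Submodule.eq_bot_iff]
    rintro x ⟨hx, hr⟩
    by_contra h0
    exact (hle x hx h0).ne (QuadraticMap.mem_radical_iff'.1 hr).1
  refine ⟨P ⊔ Q.radical, fun x hx => ?_, ?_⟩
  · obtain ⟨p, hp, r, hr, rfl⟩ := Submodule.mem_sup.1 hx
    rw [add_comm, (QuadraticMap.mem_radical_iff'.1 hr).2]
    rcases eq_or_ne p 0 with rfl | h0
    · simp
    · exact (hle p hp h0).le
  · have h1 := Submodule.finrank_sup_add_finrank_inf_eq P Q.radical
    have h2 := sigPos_add_sigNeg_add_radical (Q := Q)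
    rw [hdisj, finrank_bot] at h1
    omega

/-- Weyl's inequality for the positive index. -/
theorem sigPos_add_le (Q Q' : QuadraticForm ℝ M) : sigPos (Q + Q') ≤ sigPos Q + sigPos Q' := by
  obtain ⟨W, hW, hd⟩ := exists_nonpos_finrank_add_sigPos Q
  obtain ⟨W', hW', hd'⟩ := exists_nonpos_finrank_add_sigPos Q'
  have h := sigPos_add_finrank_le_of_nonpos (Q := Q + Q') (V := W ⊓ W') fun x hx => by
    simpa using add_nonpos (hW x hx.1) (hW' x hx.2)
  have h1 := Submodule.finrank_sup_add_finrank_inf_eq W W'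
  have h2 := Submodule.finrank_le (W ⊔ W')
  omega

theorem sigPos_eq_add_of_isCompl (Q : QuadraticForm ℝ M) {A B : Submodule ℝ M} (h : IsCompl A B)
    (hQ : ∀ a ∈ A, ∀ b ∈ B, Q (a + b) = Q a + Q b) :
    sigPos Q = sigPos (Q.restrict A) + sigPos (Q.restrict B) := by
  have hdim : Module.finrank ℝ A + Module.finrank ℝ B = Module.finrank ℝ M :=
    Submodule.finrank_add_eq_of_isCompl h
  -- Subspaces of `A` and `B` span a subspace whose dimension is the sum of the two dimensions.
  have key : ∀ (S : Submodule ℝ A) (T : Submodule ℝ B),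
      Module.finrank ℝ (S.map A.subtype ⊔ T.map B.subtype : Submodule ℝ M) =
        Module.finrank ℝ S + Module.finrank ℝ T := by
    intro S T
    have h1 := Submodule.finrank_sup_add_finrank_inf_eq (S.map A.subtype) (T.map B.subtype)
    have h2 : S.map A.subtype ⊓ T.map B.subtype = ⊥ :=
      (h.disjoint.mono (Submodule.map_subtype_le A S) (Submodule.map_subtype_le B T)).eq_bot
    rwa [h2, finrank_bot, add_zero, Submodule.finrank_map_subtype_eq,
      Submodule.finrank_map_subtype_eq] at h1
  apply le_antisymm
  · obtain ⟨S, hS, hSd⟩ := exists_nonpos_finrank_add_sigPos (Q.restrict A)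
    obtain ⟨T, hT, hTd⟩ := exists_nonpos_finrank_add_sigPos (Q.restrict B)
    have := sigPos_add_finrank_le_of_nonpos (Q := Q) (V := S.map A.subtype ⊔ T.map B.subtype) <| by
      intro x hx
      obtain ⟨_, ⟨s, hs, rfl⟩, _, ⟨t, ht, rfl⟩, rfl⟩ := Submodule.mem_sup.1 hx
      rw [Submodule.subtype_apply, Submodule.subtype_apply, hQ _ s.2 _ t.2]
      exact add_nonpos (hS s hs) (hT t ht)
    rw [key] at this
    omega
  · obtain ⟨S, hSd, hS⟩ := exists_finrank_eq_sigPos_and_posDef (Q.restrict A)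
    obtain ⟨T, hTd, hT⟩ := exists_finrank_eq_sigPos_and_posDef (Q.restrict B)
    rw [← hSd, ← hTd, ← key]
    apply le_sigPos_of_posDef
    rintro ⟨x, hx⟩ hx0
    obtain ⟨_, ⟨s, hs, rfl⟩, _, ⟨t, ht, rfl⟩, rfl⟩ := Submodule.mem_sup.1 hx
    have hst : Q (s + t) = Q s + Q t := hQ _ s.2 _ t.2
    rw [QuadraticMap.restrict_apply]
    change 0 < Q (s + t)
    rw [hst]
    have hs' : s ≠ 0 → 0 < Q s := fun h0 => hS ⟨s, hs⟩ (by simpa using h0)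
    have ht' : t ≠ 0 → 0 < Q t := fun h0 => hT ⟨t, ht⟩ (by simpa using h0)
    rcases eq_or_ne s 0 with rfl | hs0 <;> rcases eq_or_ne t 0 with rfl | ht0
    · simp at hx0
    · simpa using ht' ht0
    · simpa using hs' hs0
    · exact add_pos (hs' hs0) (ht' ht0)

/-- The positive index is lower semicontinuous: by compactness of the unit sphere, a form that is
positive definite on a subspace remains so after a small perturbation. -/
theorem eventually_sigPos_le {X : Type*} [TopologicalSpace X] {Q : X → QuadraticForm ℝ M} {x₀ : X}
    (hQ : ∀ v, ContinuousAt (fun x => Q x v) x₀) : ∀ᶠ x in 𝓝 x₀, sigPos (Q x₀) ≤ sigPos (Q x) := by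
  obtain ⟨P, hPd, hP⟩ := exists_finrank_eq_sigPos_and_posDef (Q x₀)
  let b := Module.finBasis ℝ P
  let v : (Fin (Module.finrank ℝ P) → ℝ) → M := fun c => ∑ i, c i • (b i : M)
  have hv : ∀ c, v c = (b.equivFun.symm c : P) := fun c => by
    simp [v, Module.Basis.equivFun_symm_apply]
  have hexp : ∀ x c, Q x (v c) = ∑ i, ∑ j, c i * (c j *
      ((Q x ((b i : M) + b j) - Q x (b i) - Q x (b j)) / 2)) := by
    intro x c
    have : Q x (v c) = QuadraticMap.associated (R := ℝ) (Q x) (v c) (v c) := by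
      rw [QuadraticMap.associated_eq_self_apply]
    rw [this]
    simp only [v, map_sum, LinearMap.sum_apply, map_smul, LinearMap.smul_apply, smul_eq_mul,
      QuadraticMap.associated_apply]
    refine Finset.sum_congr rfl fun i _ => ?_
    rw [← Finset.mul_sum]
    congr 1
    refine Finset.sum_congr rfl fun j _ => ?_
    rw [add_comm (b j : M)]
    simp [div_eq_inv_mul]
    grind
  have hcont : ∀ c, ContinuousAt (fun p : X × (Fin (Module.finrank ℝ P) → ℝ) => Q p.1 (v p.2))
      (x₀, c) := by
    intro c
    simp only [hexp]
    have h1 : ∀ w, ContinuousAt (fun p : X × (Fin (Module.finrank ℝ P) → ℝ) => Q p.1 w) (x₀, c) :=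
      fun w => ContinuousAt.comp (f := Prod.fst) (x := (x₀, c)) (hQ w) continuousAt_fst
    have h2 : ∀ i, ContinuousAt (fun p : X × (Fin (Module.finrank ℝ P) → ℝ) => p.2 i) (x₀, c) :=
      fun i => ((continuous_apply i).comp continuous_snd).continuousAt
    refine tendsto_finsetSum _ fun i _ => tendsto_finsetSum _ fun j _ => ?_
    exact (h2 i).mul ((h2 j).mul ((((h1 _).sub (h1 _)).sub (h1 _)).div_const 2))
  have hev : ∀ᶠ x in 𝓝 x₀, ∀ c ∈ Metric.sphere (0 : Fin (Module.finrank ℝ P) → ℝ) 1,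
      0 < Q x (v c) := by
    apply (isCompact_sphere _ _).eventually_forall_of_forall_eventually
    intro c hc
    refine (hcont c).eventually_const_lt ?_
    have hc0 : c ≠ 0 := by
      rintro rfl
      simp at hc
    change 0 < Q x₀ (v c)
    rw [hv]
    exact hP _ (fun h0 => hc0 (b.equivFun.symm.map_eq_zero_iff.1 h0))
  filter_upwards [hev] with x hx
  rw [← hPd]
  apply le_sigPos_of_posDef
  intro p hp
  have hc0 : b.equivFun p ≠ 0 := by simpa using hp
  have hn : ‖b.equivFun p‖ ≠ 0 := norm_ne_zero_iff.2 hc0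
  have h1 := hx (‖b.equivFun p‖⁻¹ • b.equivFun p) (by
    rw [mem_sphere_zero_iff_norm, norm_smul, norm_inv, norm_norm, inv_mul_cancel₀ hn])
  rw [hv, map_smul, LinearEquiv.symm_apply_apply, Submodule.coe_smul, QuadraticMap.map_smul,
    smul_eq_mul] at h1
  exact pos_of_mul_pos_right h1 (mul_self_nonneg _)

/-- Along a family of forms of constant rank, lower semicontinuity of both indices of inertia
makes the positive one locally constant. -/
theorem eventually_sigPos_eq {X : Type*} [TopologicalSpace X] {Q : X → QuadraticForm ℝ M} {x₀ : X}
    (hQ : ∀ v, ContinuousAt (fun x => Q x v) x₀)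
    (hrad : ∀ᶠ x in 𝓝 x₀, (Q x).radical = (Q x₀).radical) :
    ∀ᶠ x in 𝓝 x₀, sigPos (Q x) = sigPos (Q x₀) := by
  filter_upwards [eventually_sigPos_le hQ, hrad, eventually_sigPos_le (Q := fun x => -Q x)
    fun v => (hQ v).neg] with x h1 h2 h3
  have h4 := sigPos_add_sigNeg_add_radical (Q := Q x)
  have h5 := sigPos_add_sigNeg_add_radical (Q := Q x₀)
  rw [h2] at h4
  rw [sigPos_neg, sigPos_neg] at h3
  omega

end QuadraticForm

/-! ### Lagrangian subspaces and their common complements -/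

namespace Lagrangian

open Module

variable {V : Type*} [AddCommGroup V] [Module ℝ V] {ω : LinearMap.BilinForm ℝ V}

theorem finrank_eq_of_finrank_eq_two_mul {n : ℕ} (hn : finrank ℝ V = 2 * n) (L : Lagrangian ω) :
    finrank ℝ L.space = n := by
  have := L.two_mul_finrank
  omega

variable [FiniteDimensional ℝ V]

theorem transverse_of_disjoint {L L' : Lagrangian ω} (h : Disjoint L.space L'.space) :
    L.Transverse L' := by
  refine ⟨h, codisjoint_iff.2 (Submodule.eq_top_of_finrank_eq ?_)⟩
  have h1 := Submodule.finrank_sup_add_finrank_inf_eq L.space L'.space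
  rw [h.eq_bot, finrank_bot] at h1
  have h2 := L.two_mul_finrank
  have h3 := L'.two_mul_finrank
  omega

/-- A Lagrangian subspace is its own symplectic orthogonal. -/
theorem mem_of_forall_eq_zero (hnd : ω.Nondegenerate) (L : Lagrangian ω) {v : V}
    (hv : ∀ x ∈ L.space, ω x v = 0) : v ∈ L.space := by
  have hle : L.space ≤ ω.orthogonal L.space := fun x hx =>
    LinearMap.BilinForm.mem_orthogonal_iff.2 fun y hy => L.isotropic y hy x hx
  have h1 := LinearMap.BilinForm.finrank_orthogonal hnd L.space
  have h2 := L.two_mul_finrank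
  rw [Submodule.eq_of_le_of_finrank_eq hle (by omega)]
  exact LinearMap.BilinForm.mem_orthogonal_iff.2 hv

/-- Finitely many Lagrangians have a common Lagrangian complement. An isotropic subspace `W` that
is maximal among those meeting all of them trivially is Lagrangian: otherwise each `L i + W` meets
the symplectic orthogonal of `W` in a proper subspace, and finitely many proper subspaces do not
cover it. -/
theorem exists_forall_transverse (halt : ω.IsAlt) (hnd : ω.Nondegenerate) {ι : Type*} [Finite ι]
    [Nonempty ι] (L : ι → Lagrangian ω) : ∃ A : Lagrangian ω, ∀ i, (L i).Transverse A := by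
  obtain ⟨W, ⟨hiso, hdis⟩, hmax⟩ := (wellFounded_gt (α := Submodule ℝ V)).has_min
    {W | (∀ x ∈ W, ∀ y ∈ W, ω x y = 0) ∧ ∀ i, Disjoint (L i).space W}
    ⟨⊥, by simp, fun i => disjoint_bot_right⟩
  have horth := LinearMap.BilinForm.finrank_orthogonal hnd W
  have hWO : W ≤ ω.orthogonal W := fun x hx =>
    LinearMap.BilinForm.mem_orthogonal_iff.2 fun y hy => hiso y hy x hx
  have hWV := Submodule.finrank_le W
  have hWO' := Submodule.finrank_mono hWO
  suffices hdim : 2 * finrank ℝ W = finrank ℝ V from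
    ⟨⟨W, hiso, hdim⟩, fun i => transverse_of_disjoint (hdis i)⟩
  by_contra hdim
  let p : ι → Submodule ℝ (ω.orthogonal W) := fun i =>
    ((L i).space ⊔ W).comap (ω.orthogonal W).subtype
  have hp : ∀ i, p i ≠ ⊤ := by
    intro i hi
    have hle : ω.orthogonal W ≤ (L i).space ⊔ W := Submodule.comap_subtype_eq_top.1 hi
    have hbot : (L i).space ⊓ ω.orthogonal W = ⊥ := by
      rw [eq_bot_iff, ← (hdis i).eq_bot]
      refine le_inf inf_le_left fun x hx => ?_
      rw [← LinearMap.BilinForm.orthogonal_orthogonal hnd halt.isRefl W]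
      refine LinearMap.BilinForm.orthogonal_le hle
        (LinearMap.BilinForm.mem_orthogonal_iff.2 fun y hy => ?_)
      obtain ⟨l, hl, w, hw, rfl⟩ := Submodule.mem_sup.1 hy
      have h1 := (L i).isotropic l hl x hx.1
      have h2 : ω w x = 0 := LinearMap.BilinForm.mem_orthogonal_iff.1 hx.2 w hw
      simp [h1, h2]
    have h1 := Submodule.finrank_sup_add_finrank_inf_eq (L i).space (ω.orthogonal W)
    rw [hbot, finrank_bot] at h1
    have h2 := Submodule.finrank_le ((L i).space ⊔ ω.orthogonal W)
    have h3 := (L i).two_mul_finrank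
    omega
  obtain ⟨⟨v, hvO⟩, hv⟩ : ∃ v, ∀ i, v ∉ p i := by
    by_contra! hcov
    obtain ⟨i, hi⟩ := Subspace.exists_eq_top_of_iUnion_eq_univ (p := p)
      (Set.eq_univ_iff_forall.2 fun v => Set.mem_iUnion.2 (hcov v))
    exact hp i hi
  have hvO' : ∀ w ∈ W, ω w v = 0 := fun w hw => LinearMap.BilinForm.mem_orthogonal_iff.1 hvO w hw
  have hvO'' : ∀ w ∈ W, ω v w = 0 := fun w hw => by
    rw [← halt.neg_eq, hvO' w hw, neg_zero]
  have hvL : ∀ i, v ∉ (L i).space ⊔ W := hv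
  refine hmax (W ⊔ Submodule.span ℝ {v}) ⟨?_, fun i => ?_⟩ ?_
  · intro x hx y hy
    obtain ⟨w, hw, _, hc, rfl⟩ := Submodule.mem_sup.1 hx
    obtain ⟨w', hw', _, hc', rfl⟩ := Submodule.mem_sup.1 hy
    obtain ⟨c, rfl⟩ := Submodule.mem_span_singleton.1 hc
    obtain ⟨c', rfl⟩ := Submodule.mem_span_singleton.1 hc'
    simp [hiso w hw w' hw', hvO' w hw, hvO'' w' hw', halt v]
  · rw [Submodule.disjoint_def]
    intro x hx hxW
    obtain ⟨w, hw, _, hc, rfl⟩ := Submodule.mem_sup.1 hxW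
    obtain ⟨c, rfl⟩ := Submodule.mem_span_singleton.1 hc
    rcases eq_or_ne c 0 with rfl | h0
    · rw [zero_smul, add_zero] at hx ⊢
      exact Submodule.disjoint_def.1 (hdis i) w hx hw
    · refine absurd ?_ (hvL i)
      rw [← Submodule.smul_mem_iff _ h0, show c • v = (w + c • v) + -w by abel]
      exact Submodule.add_mem_sup hx (W.neg_mem hw)
  · obtain ⟨i⟩ := ‹Nonempty ι›
    refine lt_of_le_of_ne le_sup_left fun h => hvL i (Submodule.mem_sup_right ?_)
    rw [h]
    exact Submodule.mem_sup_right (Submodule.mem_span_singleton_self v)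

theorem exists_transverse (halt : ω.IsAlt) (hnd : ω.Nondegenerate) (L₁ L₂ L₃ : Lagrangian ω) :
    ∃ A : Lagrangian ω, L₁.Transverse A ∧ L₂.Transverse A ∧ L₃.Transverse A := by
  obtain ⟨A, hA⟩ := exists_forall_transverse halt hnd ![L₁, L₂, L₃]
  exact ⟨A, hA 0, hA 1, hA 2⟩

end Lagrangian

/-! ### The quadratic form of a Lagrangian splitting -/

section SplitForm

open Module

variable {V : Type*} [AddCommGroup V] [Module ℝ V]

open Classical in
/-- The quadratic form `a + y ↦ ω (y, a)` on `V = A ⊕ Y`. Its restriction to a Lagrangian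
complement `X` of `A` is the quadratic form of the chart `φ_{X,A}(Y)`. The value is `0` if `A` and
`Y` are not complementary. -/
noncomputable def splitForm (ω : LinearMap.BilinForm ℝ V) (A Y : Submodule ℝ V) :
    QuadraticForm ℝ V :=
  if h : IsCompl A Y then LinearMap.BilinMap.toQuadraticMap (-(ω ∘ₗ A.projection Y h)) else 0

/-- The positive index on `X` of the form `splitForm ω A Y`, as a function of three subspaces. -/
noncomputable def relCoindex (ω : LinearMap.BilinForm ℝ V) (X A Y : Submodule ℝ V) : ℕ :=
  sigPos ((splitForm ω A Y).restrict X)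

variable {ω : LinearMap.BilinForm ℝ V} {A Y : Submodule ℝ V}

theorem splitForm_apply (h : IsCompl A Y) (v : V) :
    splitForm ω A Y v = -ω (A.projection Y h v) v := by
  simp [splitForm, h]

theorem splitForm_add_apply (halt : ω.IsAlt) (h : IsCompl A Y) {a y : V} (ha : a ∈ A)
    (hy : y ∈ Y) : splitForm ω A Y (a + y) = ω y a := by
  rw [splitForm_apply h, map_add (A.projection Y h), Submodule.projection_apply_of_mem_left h ha,
    (Submodule.projection_apply_eq_zero_iff h).2 hy, add_zero, map_add, halt a, zero_add,
    halt.neg_eq]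

/-- Complements `X` and `Y` of `A` are identified along `A`. -/
theorem exists_linearEquiv_sub_mem {X Y A : Submodule ℝ V} (hX : IsCompl X A) (hY : IsCompl Y A) :
    ∃ e : X ≃ₗ[ℝ] Y, ∀ x, (e x : V) - x ∈ A := by
  refine ⟨(A.quotientEquivOfIsCompl X hX.symm).symm.trans (A.quotientEquivOfIsCompl Y hY.symm),
    fun x => ?_⟩
  rw [← Submodule.Quotient.eq]
  exact Submodule.mk_quotientEquivOfIsCompl_apply hY.symm (Submodule.Quotient.mk (x : V))

end SplitForm

namespace Lagrangian

open Module

variable {V : Type*} [AddCommGroup V] [Module ℝ V] {ω : LinearMap.BilinForm ℝ V}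

theorem chart_self_apply (L₀ A L : Lagrangian ω) (h : L.Transverse A) (x : L₀.space) :
    L₀.chart A L h x x = splitForm ω A.space L.space x := by
  rw [splitForm_apply h.symm]
  simp [chart, graphMap]

/-- The dependence on `Y` of the value at `v = x + a ∈ X₀ ⊕ A` of the form of the splitting
`V = Y ⊕ A` is, up to a constant, minus the value at `x` of the chart of `Y`. -/
theorem splitForm_eq_sub_chart (halt : ω.IsAlt) {X₀ A Y : Lagrangian ω}
    (h : Y.Transverse A) (x : X₀.space) {a : V} (ha : a ∈ A.space) :
    splitForm ω Y.space A.space (x + a) = ω a x - X₀.chart A Y h x x := by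
  have h1 := add_graphMap_mem X₀ A Y h x
  have hT := (X₀.graphMap A Y h x).2
  have h2 := splitForm_add_apply halt h h1 (A.space.sub_mem ha hT)
  have h3 := A.isotropic _ ha _ hT
  have h4 := halt (X₀.graphMap A Y h x : V)
  rw [show (x : V) + X₀.graphMap A Y h x + (a - X₀.graphMap A Y h x) = x + a by abel] at h2
  rw [h2]
  simp only [map_add, map_sub, LinearMap.sub_apply, h3, h4, chart, LinearMap.compl₁₂_apply,
    LinearMap.comp_apply, Submodule.subtype_apply]
  ring

theorem chartCoindex_eq_relCoindex (L₀ A L : Lagrangian ω) (h : L.Transverse A) :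
    L₀.chartCoindex A L h = relCoindex ω L₀.space A.space L.space := by
  unfold chartCoindex relCoindex
  congr 1
  ext x
  exact chart_self_apply L₀ A L h x

/-- On an isotropic subspace `X`, the polar form of `splitForm ω A Y` simplifies. -/
theorem polar_splitForm (halt : ω.IsAlt) {X A Y : Lagrangian ω} (hYA : Y.Transverse A) {a y v : V}
    (ha : a ∈ A.space) (hy : y ∈ Y.space) (hx : a + y ∈ X.space) (hv : v ∈ X.space) :
    QuadraticMap.polar (splitForm ω A.space Y.space) (a + y) v = -(2 * ω a v) := by
  obtain ⟨b, z, hb, hz, rfl⟩ := Submodule.codisjoint_iff_exists_add_eq.1 hYA.symm.codisjoint v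
  have h1 := X.isotropic _ hx _ hv
  have h2 := A.isotropic _ ha _ hb
  have h3 := Y.isotropic _ hy _ hz
  rw [QuadraticMap.polar, show a + y + (b + z) = (a + b) + (y + z) by abel,
    splitForm_add_apply halt hYA.symm ha hy, splitForm_add_apply halt hYA.symm hb hz,
    splitForm_add_apply halt hYA.symm (A.space.add_mem ha hb) (Y.space.add_mem hy hz)]
  have h4 := halt.neg_eq a z
  simp only [map_add, LinearMap.add_apply] at h1 ⊢
  linarith

/-- On `X`, the kernel of the form of the splitting `V = A ⊕ Y` is `X ∩ Y`. -/
theorem radical_splitForm_restrict [FiniteDimensional ℝ V] (halt : ω.IsAlt)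
    (hnd : ω.Nondegenerate) {X A Y : Lagrangian ω} (hXA : X.Transverse A) (hYA : Y.Transverse A) :
    ((splitForm ω A.space Y.space).restrict X.space).radical =
      Y.space.comap X.space.subtype := by
  rw [QuadraticMap.radical_eq_ker_polarBilin]
  ext ⟨x, hx⟩
  obtain ⟨a, y, ha, hy, rfl⟩ := Submodule.codisjoint_iff_exists_add_eq.1 hYA.symm.codisjoint x
  rw [LinearMap.mem_ker, Submodule.mem_comap, LinearMap.ext_iff]
  have hpol : ∀ v : X.space, (((splitForm ω A.space Y.space).restrict X.space).polarBilin
      ⟨a + y, hx⟩) v = -(2 * ω a v) := fun v => polar_splitForm halt hYA ha hy hx v.2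
  simp only [hpol, LinearMap.zero_apply, neg_eq_zero, mul_eq_zero, OfNat.ofNat_ne_zero, false_or,
    Submodule.subtype_apply, Subtype.forall]
  constructor
  · intro h
    have haX : a ∈ X.space := mem_of_forall_eq_zero hnd X fun v hv => by
      rw [← halt.neg_eq, h v hv, neg_zero]
    rw [Submodule.disjoint_def.1 hXA.disjoint a haX ha, zero_add]
    exact hy
  · intro h v hv
    have haY : a ∈ Y.space := by simpa using Y.space.sub_mem h hy
    rw [Submodule.disjoint_def.1 hYA.disjoint a haY ha]
    simp

/-- The auxiliary form `q` on `V = X ⊕ A` that agrees with `splitForm ω A Y` on `X` and with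
`splitForm ω X A'` on `A` restricts on `Y` to the form of the splitting `V = A' ⊕ Y`, read on `X`
by projecting `Y` to `X` along `A'`. -/
theorem sigPos_restrict_eq_relCoindex (halt : ω.IsAlt) {X A A' Y : Lagrangian ω}
    (hXA' : X.Transverse A') (hYA : Y.Transverse A) (hYA' : Y.Transverse A') (hXA : X.Transverse A)
    {q : QuadraticForm ℝ V}
    (hq : ∀ x ∈ X.space, ∀ u ∈ A.space, q (x + u) =
      splitForm ω A.space Y.space x + splitForm ω X.space A'.space u) :
    sigPos (q.restrict Y.space) = relCoindex ω X.space A'.space Y.space := by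
  obtain ⟨e, he⟩ := exists_linearEquiv_sub_mem hYA' hXA'
  refine QuadraticForm.sigPos_eq_of_linearEquiv e fun ⟨y, hy⟩ => ?_
  obtain ⟨x, u, hx, hu, rfl⟩ := Submodule.codisjoint_iff_exists_add_eq.1 hXA.codisjoint y
  set x' := e ⟨x + u, hy⟩ with hx'
  have ha' : (x' : V) - (x + u) ∈ A'.space := he ⟨x + u, hy⟩
  rw [QuadraticMap.restrict_apply, QuadraticMap.restrict_apply]
  change _ = q (x + u)
  rw [hq x hx u hu]
  have e1 : splitForm ω A'.space Y.space x' = ω (x + u) (x' - (x + u)) := by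
    rw [← splitForm_add_apply halt hYA'.symm ha' hy, sub_add_cancel]
  have e2 : splitForm ω A.space Y.space x = ω (x + u) (-u) := by
    rw [← splitForm_add_apply halt hYA.symm (A.space.neg_mem hu) hy]
    congr 1
    abel
  have e3 : splitForm ω X.space A'.space u = ω (-(x' - (x + u))) (x' - x) := by
    rw [← splitForm_add_apply halt hXA' (X.space.sub_mem x'.2 hx) (A'.space.neg_mem ha')]
    congr 1
    abel
  have h1 := X.isotropic _ x'.2 _ hx
  have h2 := halt u
  have h3 := halt x
  have h4 := halt x'
  have h5 := halt.neg_eq x' x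
  have h6 := halt.neg_eq x' u
  have h7 := halt.neg_eq x u
  rw [e1, e2, e3]
  simp only [map_add, map_sub, map_neg, LinearMap.add_apply, LinearMap.sub_apply,
    LinearMap.neg_apply]
  linarith

/-- The exchange identity: for Lagrangians with `X`, `Y` both transverse to `A`, `A'`, the change
of `n₊(φ_{X,A}(Y))` when `A` is replaced by `A'` is the difference of a function of `Y` and of its
value at `X`. Both sides compute the positive index of the form
`q (x + u) = splitForm A Y x + splitForm X A' u` on `V = X ⊕ A`, for which not only `X` and `A`
but also `Y` and `A'` are orthogonal. -/
theorem relCoindex_add_relCoindex [FiniteDimensional ℝ V] (halt : ω.IsAlt) {X Y A A' : Lagrangian ω}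
    (hXA : X.Transverse A) (hXA' : X.Transverse A') (hYA : Y.Transverse A)
    (hYA' : Y.Transverse A') :
    relCoindex ω X.space A.space Y.space + relCoindex ω A.space X.space A'.space =
      relCoindex ω X.space A'.space Y.space + relCoindex ω A.space Y.space A'.space := by
  let q : QuadraticForm ℝ V :=
    (splitForm ω A.space Y.space).comp (X.space.projection A.space hXA) +
      (splitForm ω X.space A'.space).comp (A.space.projection X.space hXA.symm)
  have hq : ∀ x ∈ X.space, ∀ u ∈ A.space, q (x + u) =
      splitForm ω A.space Y.space x + splitForm ω X.space A'.space u := by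
    intro x hx u hu
    simp [q, map_add, Submodule.projection_apply_of_mem_left _ hx,
      Submodule.projection_apply_of_mem_left _ hu,
      (Submodule.projection_apply_eq_zero_iff hXA).2 hu,
      (Submodule.projection_apply_eq_zero_iff hXA.symm).2 hx]
  have hX : sigPos (q.restrict X.space) = relCoindex ω X.space A.space Y.space := by
    refine congrArg sigPos (QuadraticMap.ext fun x => ?_)
    simpa using hq x x.2 0 A.space.zero_mem
  have hA : sigPos (q.restrict A.space) = relCoindex ω A.space X.space A'.space := by
    refine congrArg sigPos (QuadraticMap.ext fun x => ?_)
    simpa using hq 0 X.space.zero_mem x x.2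
  have hY := sigPos_restrict_eq_relCoindex halt hXA' hYA hYA' hXA hq
  have hA' : sigPos (q.restrict A'.space) = relCoindex ω A.space Y.space A'.space :=
    sigPos_restrict_eq_relCoindex halt hYA.symm hXA'.symm hYA'.symm hXA.symm
      fun x hx u hu => by rw [add_comm, hq u hu x hx, add_comm]
  rw [← hX, ← hA, ← hY, ← hA', ← QuadraticForm.sigPos_eq_add_of_isCompl q hXA,
    ← QuadraticForm.sigPos_eq_add_of_isCompl q hYA']
  · intro y hy a' ha'
    obtain ⟨x, u, hx, hu, rfl⟩ := Submodule.codisjoint_iff_exists_add_eq.1 hXA.codisjoint y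
    obtain ⟨x', u', hx', hu', rfl⟩ := Submodule.codisjoint_iff_exists_add_eq.1 hXA.codisjoint a'
    rw [show x + u + (x' + u') = (x + x') + (u + u') by abel, hq x hx u hu, hq x' hx' u' hu',
      hq _ (X.space.add_mem hx hx') _ (A.space.add_mem hu hu')]
    have h1 := polar_splitForm halt hYA (A.space.neg_mem hu) hy
      (show -u + (x + u) ∈ X.space by simpa using hx) hx'
    have h2 := polar_splitForm halt hXA'.symm (X := A) (X.space.neg_mem hx') ha'
      (show -x' + (x' + u') ∈ A.space by simpa using hu') hu
    rw [show -u + (x + u) = x by abel] at h1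
    rw [show -x' + (x' + u') = u' by abel, QuadraticMap.polar_comm] at h2
    have h3 := halt.neg_eq u x'
    simp only [QuadraticMap.polar, map_neg, LinearMap.neg_apply] at h1 h2
    linarith
  · intro x hx u hu
    rw [hq x hx u hu]
    have h1 := hq x hx 0 A.space.zero_mem
    have h2 := hq 0 X.space.zero_mem u hu
    rw [add_zero, QuadraticMap.map_zero, add_zero] at h1
    rw [zero_add, QuadraticMap.map_zero, zero_add] at h2
    rw [h1, h2]

end Lagrangian

/-! ### The Hörmander index -/

namespace Lagrangian

open Module

variable {V : Type*} [AddCommGroup V] [Module ℝ V] {ω : LinearMap.BilinForm ℝ V}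

section Hormander

variable [FiniteDimensional ℝ V]

/-- The difference of the coindices of `L` relative to `L₀` and to `L₁`, read with a common
complement `A` and normalized so as not to depend on `A`. -/
noncomputable def hormanderIndex (L₀ L₁ A L : Lagrangian ω) : ℤ :=
  relCoindex ω L₀.space A.space L.space - relCoindex ω L₁.space A.space L.space -
    relCoindex ω L₀.space A.space L₁.space

theorem hormanderIndex_eq (halt : ω.IsAlt) {L₀ L₁ A A' L : Lagrangian ω}
    (h₀ : L₀.Transverse A) (h₁ : L₁.Transverse A) (h : L.Transverse A)
    (h₀' : L₀.Transverse A') (h₁' : L₁.Transverse A') (h' : L.Transverse A') :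
    hormanderIndex L₀ L₁ A L = hormanderIndex L₀ L₁ A' L := by
  have e1 := relCoindex_add_relCoindex halt h₀ h₀' h h'
  have e2 := relCoindex_add_relCoindex halt h₁ h₁' h h'
  have e3 := relCoindex_add_relCoindex halt h₀ h₀' h₁ h₁'
  unfold hormanderIndex
  omega

/-- Let `B` and `S` be the forms on `L₀` of `L` and `L₁`. The form of `L` on `L₁` is `B - S`, so
the index is `n₊(B) - n₊(B - S) - n₊(S)`. It is at most `0` and at least `-(n₊(S) + n₋(S))`,
which is minus the rank of `S`; and the kernel of `S` is `L₀ ∩ L₁`. -/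
theorem hormanderIndex_bounds (halt : ω.IsAlt) (hnd : ω.Nondegenerate) {L₀ L₁ A L : Lagrangian ω}
    (h₀ : L₀.Transverse A) (h₁ : L₁.Transverse A) (h : L.Transverse A) :
    hormanderIndex L₀ L₁ A L ≤ 0 ∧
      (finrank ℝ (L₀.space ⊓ L₁.space : Submodule ℝ V) : ℤ) - finrank ℝ L₀.space ≤
        hormanderIndex L₀ L₁ A L := by
  set B := (splitForm ω A.space L.space).restrict L₀.space with hB
  set S := (splitForm ω A.space L₁.space).restrict L₀.space with hS
  obtain ⟨e, he⟩ := exists_linearEquiv_sub_mem h₀ h₁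
  have hC : sigPos (B + -S) = relCoindex ω L₁.space A.space L.space := by
    refine QuadraticForm.sigPos_eq_of_linearEquiv e fun x => ?_
    obtain ⟨a, y, ha, hy, hx⟩ := Submodule.codisjoint_iff_exists_add_eq.1 h.symm.codisjoint (x : V)
    have hs := he x
    have e1 : splitForm ω A.space L.space (e x) = ω y (e x - x + a) := by
      rw [← splitForm_add_apply halt h.symm (A.space.add_mem hs ha) hy, add_assoc, hx,
        sub_add_cancel]
    have e2 : splitForm ω A.space L.space x = ω y a := by
      rw [← splitForm_add_apply halt h.symm ha hy, hx]
    have e3 : splitForm ω A.space L₁.space x = ω (e x) (-(e x - x)) := by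
      rw [← splitForm_add_apply halt h₁.symm (A.space.neg_mem hs) (e x).2]
      congr 1
      abel
    have h5 := A.isotropic _ ha _ hs
    have h6 := halt (e x - x : V)
    simp only [add_apply, neg_apply, hB, hS,
      QuadraticMap.restrict_apply]
    rw [e1, e2, e3, show (e x : V) = (e x - x) + (a + y) by rw [hx]; abel]
    rw [show (e x : V) - x + (a + y) - x = e x - x by rw [hx]; abel]
    have h7 := halt.neg_eq y (e x - x : V)
    simp only [map_add, map_neg, LinearMap.add_apply]
    linarith
  have h1 := QuadraticForm.sigPos_add_le (B + -S) S
  have h2 := QuadraticForm.sigPos_add_le B (-S)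
  rw [show B + -S + S = B by abel] at h1
  have h3 := QuadraticForm.sigPos_add_sigNeg_add_radical (Q := S)
  rw [radical_splitForm_restrict halt hnd h₀ h₁,
    ← Submodule.finrank_map_subtype_eq, Submodule.map_comap_subtype] at h3
  rw [sigPos_neg, hC] at h2
  rw [hC] at h1
  have h4 : sigPos B = relCoindex ω L₀.space A.space L.space := rfl
  have h5 : sigPos S = relCoindex ω L₀.space A.space L₁.space := rfl
  unfold hormanderIndex
  omega

end Hormander

/-! ### Local constancy in the manifold topology -/

open Filter Topology

theorem continuousAt_splitForm (halt : ω.IsAlt) {A Y₀ : Lagrangian ω}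
    (h : Y₀.Transverse A) (v : V) :
    ContinuousAt (fun Y : Lagrangian ω => splitForm ω Y.space A.space v) Y₀ := by
  obtain ⟨x, a, hx, ha, rfl⟩ := Submodule.codisjoint_iff_exists_add_eq.1 h.codisjoint v
  lift x to Y₀.space using hx
  rw [ContinuousAt, tendsto_nhds]
  intro O hO hmem
  let O' : Set (LinearMap.BilinForm ℝ Y₀.space) := {B | ω a x - B x x ∈ O}
  have hO' : @IsOpen _ (bilinFormTopology Y₀.space) O' := by
    let _ := bilinFormTopology Y₀.space
    have : Continuous fun B : LinearMap.BilinForm ℝ Y₀.space => B x x :=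
      (continuous_apply_apply x x).comp
        (continuous_induced_dom
          (f := fun (B : LinearMap.BilinForm ℝ Y₀.space) (y z : Y₀.space) => B y z))
    exact hO.preimage (continuous_const.sub this)
  refine mem_nhds_iff.2 ⟨{L | ∃ h : L.Transverse A, Y₀.chart A L h ∈ O'}, ?_,
    TopologicalSpace.isOpen_generateFrom_of_mem ⟨Y₀, A, h, O', hO', rfl⟩, h, ?_⟩
  · rintro L ⟨hL, hmemL⟩
    rw [Set.mem_preimage, splitForm_eq_sub_chart halt hL x ha]
    exact hmemL
  · change _ ∈ O
    rwa [← splitForm_eq_sub_chart halt h x ha]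

variable [FiniteDimensional ℝ V]

theorem isOpen_setOf_transverse (halt : ω.IsAlt) (hnd : ω.Nondegenerate) (A : Lagrangian ω) :
    IsOpen {L : Lagrangian ω | L.Transverse A} := by
  obtain ⟨L₀, h, -⟩ := exists_transverse halt hnd A A A
  refine TopologicalSpace.isOpen_generateFrom_of_mem
    ⟨L₀, A, h.symm, Set.univ, @isOpen_univ _ (bilinFormTopology L₀.space), ?_⟩
  simp

/-- The form on `A` of the splitting `V = Y ⊕ A'` depends continuously on `Y` and has the
constant kernel `A ∩ A'`. -/
theorem eventually_relCoindex_eq (halt : ω.IsAlt) (hnd : ω.Nondegenerate) {A A' Y₀ : Lagrangian ω}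
    (h : Y₀.Transverse A) (h' : Y₀.Transverse A') :
    ∀ᶠ Y : Lagrangian ω in 𝓝 Y₀, relCoindex ω A.space Y.space A'.space =
      relCoindex ω A.space Y₀.space A'.space := by
  refine QuadraticForm.eventually_sigPos_eq
    (Q := fun Y : Lagrangian ω => (splitForm ω Y.space A'.space).restrict A.space)
    (fun v => continuousAt_splitForm halt h' v) ?_
  filter_upwards [(isOpen_setOf_transverse halt hnd A).mem_nhds h,
    (isOpen_setOf_transverse halt hnd A').mem_nhds h'] with Y hY hY'
  rw [radical_splitForm_restrict halt hnd hY.symm hY'.symm,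
    radical_splitForm_restrict halt hnd h.symm h'.symm]

theorem eventually_relCoindex_sub_eq (halt : ω.IsAlt) (hnd : ω.Nondegenerate)
    {L₀ A A' Y₀ : Lagrangian ω} (h₀ : L₀.Transverse A) (h₀' : L₀.Transverse A')
    (h : Y₀.Transverse A) (h' : Y₀.Transverse A') :
    ∀ᶠ Y : Lagrangian ω in 𝓝 Y₀,
      (relCoindex ω L₀.space A.space Y.space : ℤ) - relCoindex ω L₀.space A'.space Y.space =
        (relCoindex ω L₀.space A.space Y₀.space : ℤ) -
          relCoindex ω L₀.space A'.space Y₀.space := by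
  filter_upwards [(isOpen_setOf_transverse halt hnd A).mem_nhds h,
    (isOpen_setOf_transverse halt hnd A').mem_nhds h',
    eventually_relCoindex_eq halt hnd h h'] with Y hY hY' hYeq
  have e1 := relCoindex_add_relCoindex halt h₀ h₀' h h'
  have e2 := relCoindex_add_relCoindex halt h₀ h₀' hY hY'
  omega

end Lagrangian

/-! ### Potentials along paths, and the covering space they come from -/

section Potential

open Filter Topology unitInterval

variable {X ι T : Type*} [TopologicalSpace X] [TopologicalSpace T]

instance instPreconnectedSpaceIcc (a b : ℝ) : PreconnectedSpace (Set.Icc a b) :=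
  Subtype.preconnectedSpace isPreconnected_Icc

/-- Integer valued functions `f i` on the sets `U i` of an open cover, not assumed continuous, whose
differences are locally constant on the overlaps. They represent a global section of the sheaf of
all integer valued functions modulo the locally constant ones. -/
structure LocalPotentials (ι X : Type*) [TopologicalSpace X] where
  /-- The sets of the cover. -/
  U : ι → Set X
  /-- The local functions, with irrelevant values off `U i`. -/
  f : ι → X → ℤ
  isOpen : ∀ i, IsOpen (U i)
  cover : ∀ x, ∃ i, x ∈ U i
  eventually_sub_eq : ∀ i j, ∀ x ∈ U i ∩ U j, ∀ᶠ y in 𝓝 x, f i y - f j y = f i x - f j x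

namespace LocalPotentials

variable (P : LocalPotentials ι X)

/-- `g` is a potential along `γ` if it differs from each `f i ∘ γ` by a locally constant function
on the preimage of `U i`. -/
def IsPotential (γ : T → X) (g : T → ℤ) : Prop :=
  ∀ t i, γ t ∈ P.U i → ∀ᶠ s in 𝓝 t, g s - P.f i (γ s) = g t - P.f i (γ t)

variable {P}

theorem IsPotential.comp {S : Type*} [TopologicalSpace S] {γ : T → X} {g : T → ℤ}
    (h : P.IsPotential γ g) {φ : S → T} (hφ : Continuous φ) : P.IsPotential (γ ∘ φ) (g ∘ φ) :=
  fun s i hs => hφ.continuousAt.eventually (h (φ s) i hs)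

theorem sub_eq_of_eventually [PreconnectedSpace T] {g : T → ℤ}
    (h : ∀ t, ∀ᶠ s in 𝓝 t, g s = g t) (s t : T) : g s = g t :=
  ((IsLocallyConstant.iff_eventually_eq g).2 h).apply_eq_of_preconnectedSpace s t

variable (P)

/-- The principal `ℤ`-bundle whose transition functions are the differences of the `f i`. -/
noncomputable def bundleCore : FiberBundleCore ι X ℤ where
  baseSet := P.U
  isOpen_baseSet := P.isOpen
  indexAt x := (P.cover x).choose
  mem_baseSet_at x := (P.cover x).choose_spec
  coordChange i j x k := k + (P.f i x - P.f j x)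
  coordChange_self := by simp
  continuousOn_coordChange i j := by
    rintro ⟨x, k⟩ ⟨hx, -⟩
    refine ContinuousAt.continuousWithinAt (continuousAt_snd.add ?_)
    have : Tendsto (fun y => P.f i y - P.f j y) (𝓝 x) (𝓝 (P.f i x - P.f j x)) :=
      tendsto_nhds_of_eventually_eq (P.eventually_sub_eq i j x hx)
    exact this.comp continuousAt_fst
  coordChange_comp i j k x _ v := by ring

theorem isCoveringMap_proj : IsCoveringMap P.bundleCore.proj :=
  IsCoveringMap.mk P.bundleCore.proj (fun _ => ℤ) P.bundleCore.localTrivAt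
    P.bundleCore.mem_localTrivAt_baseSet

/-- The fiber coordinate in the trivialization over `U i`, increased by `f i`. It is independent
of `i`, but in general not continuous. -/
noncomputable def height (p : P.bundleCore.TotalSpace) : ℤ :=
  (show ℤ from p.2) + P.f (P.bundleCore.indexAt p.1) p.1

theorem isPotential_height {Γ : T → P.bundleCore.TotalSpace} (hΓ : Continuous Γ) :
    P.IsPotential (P.bundleCore.proj ∘ Γ) (P.height ∘ Γ) := by
  intro t i ht
  have h1 : ContinuousAt (fun s => (P.bundleCore.localTriv i (Γ s)).2) t := by
    have := (P.bundleCore.localTriv i).continuousAt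
      ((P.bundleCore.mem_localTriv_source i (Γ t)).2 ht)
    exact (continuous_snd.continuousAt.comp this).comp hΓ.continuousAt
  have h2 : ∀ s, (P.bundleCore.localTriv i (Γ s)).2 =
      P.height (Γ s) - P.f i (P.bundleCore.proj (Γ s)) := fun s => by
    exact (add_sub_assoc _ _ _).symm
  simp only [h2] at h1
  exact h1.eventually (eventually_of_mem (isOpen_discrete {_} |>.mem_nhds rfl) fun _ h => h)

/-- Homotopy invariance of the increments of potentials is the monodromy theorem. -/
theorem exists_potential_unitInterval : ∃ W : C(I, X) → I → ℤ,
    (∀ γ : C(I, X), P.IsPotential γ (W γ)) ∧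
    ∀ γ γ' : C(I, X), γ.HomotopicRel γ' {0, 1} → W γ 1 - W γ 0 = W γ' 1 - W γ' 0 := by
  let e : X → P.bundleCore.TotalSpace := fun x => ⟨x, (0 : ℤ)⟩
  let Γ : C(I, X) → C(I, P.bundleCore.TotalSpace) := fun γ =>
    P.isCoveringMap_proj.liftPath γ (e (γ 0)) rfl
  refine ⟨fun γ => P.height ∘ Γ γ, fun γ => ?_, fun γ γ' h => ?_⟩
  · have := P.isPotential_height (Γ γ).continuous
    rwa [P.isCoveringMap_proj.liftPath_lifts γ (e (γ 0)) rfl] at this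
  · have h0 : γ 0 = γ' 0 := by
      obtain ⟨F⟩ := h
      rw [← F.eq_fst 0 (.inl rfl), F.eq_snd 0 (.inl rfl)]
    have h1 := P.isCoveringMap_proj.liftPath_apply_one_eq_of_homotopicRel h (e (γ 0)) rfl
      (by rw [← h0])
    have h2 : Γ γ' = P.isCoveringMap_proj.liftPath γ' (e (γ 0)) (by rw [← h0]) := by
      simp only [Γ, h0]
    have h3 : Γ γ 0 = Γ γ' 0 := by
      rw [h2]
      simp only [Γ, IsCoveringMap.liftPath_zero]
    change P.height (Γ γ 1) - P.height (Γ γ 0) = P.height (Γ γ' 1) - P.height (Γ γ' 0)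
    rw [← h3, h2, ← h1]

theorem exists_isPotential {a b : ℝ} (hab : a ≤ b) (ℓ : C(Set.Icc a b, X)) :
    ∃ g, P.IsPotential ℓ g := by
  rcases hab.lt_or_eq with h | rfl
  · obtain ⟨W, hW, -⟩ := P.exists_potential_unitInterval
    let φ := iccHomeoI a b h
    have := (hW (ℓ.comp ⟨φ.symm, φ.symm.continuous⟩)).comp φ.continuous
    have hφ : ℓ.comp ⟨φ.symm, φ.symm.continuous⟩ ∘ φ = ℓ := by
      ext t
      simp
    rw [hφ] at this
    exact ⟨_, this⟩
  · refine ⟨fun _ => 0, fun t i _ => Eventually.of_forall fun s => ?_⟩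
    rw [Subsingleton.elim s t]

variable {P}

theorem IsPotential.sub_eq_sub {γ : T → X} {g g' : T → ℤ} [PreconnectedSpace T]
    (hg : P.IsPotential γ g) (hg' : P.IsPotential γ g') (s t : T) :
    g s - g t = g' s - g' t := by
  have := sub_eq_of_eventually (g := fun s => g s - g' s) (fun t => by
    obtain ⟨i, hi⟩ := P.cover (γ t)
    filter_upwards [hg t i hi, hg' t i hi] with s h1 h2
    omega) s t
  omega

/-- The increment of a potential along a path is invariant under fixed-endpoint homotopies. -/
theorem IsPotential.sub_eq_sub_of_homotopicRel {a b : ℝ} (hab : a ≤ b) {ℓ ℓ' : C(Set.Icc a b, X)}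
    {g g' : Set.Icc a b → ℤ} (hg : P.IsPotential ℓ g) (hg' : P.IsPotential ℓ' g')
    (h : ContinuousMap.HomotopicRel ℓ ℓ'
      {⟨a, Set.left_mem_Icc.2 hab⟩, ⟨b, Set.right_mem_Icc.2 hab⟩}) :
    g ⟨b, Set.right_mem_Icc.2 hab⟩ - g ⟨a, Set.left_mem_Icc.2 hab⟩ =
      g' ⟨b, Set.right_mem_Icc.2 hab⟩ - g' ⟨a, Set.left_mem_Icc.2 hab⟩ := by
  rcases hab.lt_or_eq with hlt | rfl
  · obtain ⟨W, hW, hW'⟩ := P.exists_potential_unitInterval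
    let φ : C(I, Set.Icc a b) := ⟨(iccHomeoI a b hlt).symm, (iccHomeoI a b hlt).symm.continuous⟩
    have h0 : φ 0 = ⟨a, Set.left_mem_Icc.2 hab⟩ := Subtype.ext (by simp [φ])
    have h1 : φ 1 = ⟨b, Set.right_mem_Icc.2 hab⟩ := Subtype.ext (by simp [φ])
    have hh : (ℓ.comp φ).HomotopicRel (ℓ'.comp φ) {0, 1} := by
      obtain ⟨F⟩ := h
      refine ⟨⟨F.toHomotopy.compContinuousMap φ, fun t x hx => F.prop' t (φ x) ?_⟩⟩
      rcases hx with rfl | rfl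
      · exact .inl h0
      · exact .inr h1
    have e1 := (hg.comp φ.continuous).sub_eq_sub (hW (ℓ.comp φ)) 1 0
    have e2 := (hg'.comp φ.continuous).sub_eq_sub (hW (ℓ'.comp φ)) 1 0
    rw [← h0, ← h1]
    exact e1.trans ((hW' _ _ hh).trans e2.symm)
  · simp

end LocalPotentials

end Potential

/-! ### Existence, uniqueness and comparison of Maslov indices -/

section Maslov

open Filter Topology Set

namespace Lagrangian

open Module

variable {V : Type*} [AddCommGroup V] [Module ℝ V] {ω : LinearMap.BilinForm ℝ V}
  [FiniteDimensional ℝ V]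

/-- The local potentials `L ↦ n₊(φ_{L₀,A}(L))` on the sets `Λ⁰(A)`, indexed by the Lagrangian
complements `A` of `L₀`. -/
noncomputable def maslovPotentials (halt : ω.IsAlt) (hnd : ω.Nondegenerate) (L₀ : Lagrangian ω) :
    LocalPotentials {A : Lagrangian ω // L₀.Transverse A} (Lagrangian ω) where
  U A := {L | L.Transverse A.1}
  f A L := relCoindex ω L₀.space A.1.space L.space
  isOpen A := isOpen_setOf_transverse halt hnd A.1
  cover L := by
    obtain ⟨A, h₀, h, -⟩ := exists_transverse halt hnd L₀ L L
    exact ⟨⟨A, h₀⟩, h⟩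
  eventually_sub_eq A A' _ hL := eventually_relCoindex_sub_eq halt hnd A.2 A'.2 hL.1 hL.2

variable {halt : ω.IsAlt} {hnd : ω.Nondegenerate}

/-- On a path inside one chart domain `Λ⁰(A)`, a potential differs from the coindex of the chart by
a constant. -/
theorem isPotential_sub_eq {L₀ A : Lagrangian ω} (hA : L₀.Transverse A) {T : Type*}
    [TopologicalSpace T] [PreconnectedSpace T] {γ : T → Lagrangian ω} {g : T → ℤ}
    (hg : (maslovPotentials halt hnd L₀).IsPotential γ g) (h : ∀ t, (γ t).Transverse A) (s t : T) :
    g s - g t = (L₀.chartCoindex A (γ s) (h s) : ℤ) - L₀.chartCoindex A (γ t) (h t) := by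
  have := LocalPotentials.sub_eq_of_eventually
    (g := fun s => g s - relCoindex ω L₀.space A.space (γ s).space)
    (fun t => hg t ⟨A, hA⟩ (h t)) s t
  rw [chartCoindex_eq_relCoindex, chartCoindex_eq_relCoindex]
  omega

theorem exists_isMaslovIndex (halt : ω.IsAlt) (hnd : ω.Nondegenerate) (L₀ : Lagrangian ω) :
    ∃ μ : LagrangianPathFunction ω, IsMaslovIndex ω L₀ μ := by
  choose g hg using fun (a b : ℝ) (hab : a ≤ b) (ℓ : C(Icc a b, Lagrangian ω)) =>
    (maslovPotentials halt hnd L₀).exists_isPotential hab ℓ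
  refine ⟨fun a b hab ℓ => g a b hab ℓ ⟨b, right_mem_Icc.2 hab⟩ -
    g a b hab ℓ ⟨a, left_mem_Icc.2 hab⟩, ⟨?_, ?_, ?_⟩⟩
  · intro a b hab ℓ ℓ' h
    exact (hg a b hab ℓ).sub_eq_sub_of_homotopicRel hab (hg a b hab ℓ') h
  · intro a b c hab hbc ℓ
    have h1 := (hg a b hab (restrictPath ℓ a b le_rfl hbc)).sub_eq_sub
      ((hg a c (hab.trans hbc) ℓ).comp (continuous_inclusion (Icc_subset_Icc le_rfl hbc)))
      ⟨b, right_mem_Icc.2 hab⟩ ⟨a, left_mem_Icc.2 hab⟩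
    have h2 := (hg b c hbc (restrictPath ℓ b c hab le_rfl)).sub_eq_sub
      ((hg a c (hab.trans hbc) ℓ).comp (continuous_inclusion (Icc_subset_Icc hab le_rfl)))
      ⟨c, right_mem_Icc.2 hbc⟩ ⟨b, left_mem_Icc.2 hbc⟩
    simp only [Function.comp_apply] at h1 h2
    rw [h1, h2]
    exact (sub_add_sub_cancel' _ _ _).symm
  · intro a b hab ℓ A hA h
    exact isPotential_sub_eq hA (hg a b hab ℓ) h _ _

end Lagrangian

open Lagrangian

variable {V : Type*} [AddCommGroup V] [Module ℝ V] {ω : LinearMap.BilinForm ℝ V}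
  [FiniteDimensional ℝ V] {halt : ω.IsAlt} {hnd : ω.Nondegenerate}

namespace IsMaslovIndex

/-- A Maslov index is the increment of any potential `g` along the path `ℓ`: the function
`t ↦ μ (ℓ|[a,t]) - g t` is locally constant by the concatenation and chart axioms. -/
theorem eq_sub_of_isPotential {L₀ : Lagrangian ω} {μ : LagrangianPathFunction ω}
    (hμ : IsMaslovIndex ω L₀ μ) {a b : ℝ} (hab : a ≤ b) {ℓ : C(Icc a b, Lagrangian ω)}
    {g : Icc a b → ℤ} (hg : (maslovPotentials halt hnd L₀).IsPotential ℓ g) :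
    μ a b hab ℓ = g ⟨b, right_mem_Icc.2 hab⟩ - g ⟨a, left_mem_Icc.2 hab⟩ := by
  -- The value of `μ` on short subpaths.
  have hshort : ∀ (A : Lagrangian ω), L₀.Transverse A → ∀ s t : Icc a b, ∀ hst : s ≤ t,
      (∀ r, s ≤ r → r ≤ t → (ℓ r).Transverse A) →
      μ s t hst (restrictPath ℓ s t s.2.1 t.2.2) = g t - g s := by
    intro A hA s t hst h
    have h' : ∀ r : Icc (s : ℝ) t, (restrictPath ℓ s t s.2.1 t.2.2 r).Transverse A :=
      fun r => h _ r.2.1 r.2.2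
    have h1 := isPotential_sub_eq (halt := halt) (hnd := hnd) hA
      (hg.comp (continuous_inclusion (Icc_subset_Icc s.2.1 t.2.2))) h'
      ⟨t, right_mem_Icc.2 hst⟩ ⟨s, left_mem_Icc.2 hst⟩
    rw [hμ.chart _ _ hst _ A hA h']
    exact h1.symm
  let F : Icc a b → ℤ := fun t => μ a t t.2.1 (restrictPath ℓ a t le_rfl t.2.2)
  have hadd : ∀ s t : Icc a b, ∀ hst : s ≤ t,
      F t = F s + μ s t hst (restrictPath ℓ s t s.2.1 t.2.2) := fun s t hst =>
    hμ.concat a s t s.2.1 hst (restrictPath ℓ a t le_rfl t.2.2)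
  have hloc : ∀ t, ∀ᶠ s in 𝓝 t, F s - g s = F t - g t := by
    intro t
    obtain ⟨⟨A, hA⟩, htA⟩ := (maslovPotentials halt hnd L₀).cover (ℓ t)
    have hnhds : {r | (ℓ r).Transverse A} ∈ 𝓝 t :=
      ((isOpen_setOf_transverse halt hnd A).preimage ℓ.continuous).mem_nhds htA
    filter_upwards [ordConnectedComponent_mem_nhds.2 hnhds] with s hs
    rcases le_total s t with hst | hst
    · have := hshort A hA s t hst fun r h1 h2 => hs (mem_uIcc.2 (.inr ⟨h1, h2⟩))
      rw [hadd s t hst, this]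
      ring
    · have := hshort A hA t s hst fun r h1 h2 => hs (mem_uIcc.2 (.inl ⟨h1, h2⟩))
      rw [hadd t s hst, this]
      ring
  have hab' : F ⟨a, left_mem_Icc.2 hab⟩ = 0 := by
    have := hadd ⟨a, left_mem_Icc.2 hab⟩ ⟨a, left_mem_Icc.2 hab⟩ le_rfl
    exact left_eq_add.1 this
  have := LocalPotentials.sub_eq_of_eventually (g := fun t => F t - g t) hloc
    ⟨b, right_mem_Icc.2 hab⟩ ⟨a, left_mem_Icc.2 hab⟩
  have hb : μ a b hab ℓ = F ⟨b, right_mem_Icc.2 hab⟩ := rfl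
  omega

theorem existsUnique (halt : ω.IsAlt) (hnd : ω.Nondegenerate) (L₀ : Lagrangian ω) :
    ∃! μ : LagrangianPathFunction ω, IsMaslovIndex ω L₀ μ := by
  obtain ⟨μ, hμ⟩ := exists_isMaslovIndex halt hnd L₀
  refine ⟨μ, hμ, fun ν hν => ?_⟩
  ext a b hab ℓ
  obtain ⟨g, hg⟩ := (maslovPotentials halt hnd L₀).exists_isPotential hab ℓ
  rw [hμ.eq_sub_of_isPotential hab hg, hν.eq_sub_of_isPotential hab hg]

/-- Two Maslov indices of the same path differ by the increment of the Hörmander index. -/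
theorem abs_sub_le {L₀ L₁ : Lagrangian ω} {μ ν : LagrangianPathFunction ω} (halt : ω.IsAlt)
    (hnd : ω.Nondegenerate) (hμ : IsMaslovIndex ω L₀ μ) (hν : IsMaslovIndex ω L₁ ν) {a b : ℝ}
    (hab : a ≤ b) (ℓ : C(Icc a b, Lagrangian ω)) :
    |μ a b hab ℓ - ν a b hab ℓ| ≤ (Module.finrank ℝ L₀.space : ℤ) -
      Module.finrank ℝ (L₀.space ⊓ L₁.space : Submodule ℝ V) := by
  obtain ⟨g, hg⟩ := (maslovPotentials halt hnd L₀).exists_isPotential hab ℓ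
  obtain ⟨g', hg'⟩ := (maslovPotentials halt hnd L₁).exists_isPotential hab ℓ
  rw [hμ.eq_sub_of_isPotential hab hg, hν.eq_sub_of_isPotential hab hg']
  choose A hA₀ hA₁ hA using fun L => exists_transverse halt hnd L₀ L₁ L
  let H : Lagrangian ω → ℤ := fun L => hormanderIndex L₀ L₁ (A L) L
  have hloc : ∀ t, ∀ᶠ s in 𝓝 t, g s - g' s - H (ℓ s) = g t - g' t - H (ℓ t) := by
    intro t
    have hnhds : ∀ᶠ s in 𝓝 t, (ℓ s).Transverse (A (ℓ t)) :=
      ((isOpen_setOf_transverse halt hnd (A (ℓ t))).preimage ℓ.continuous).mem_nhds (hA (ℓ t))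
    filter_upwards [hnhds, hg t ⟨A (ℓ t), hA₀ _⟩ (hA _), hg' t ⟨A (ℓ t), hA₁ _⟩ (hA _)]
      with s hs h1 h2
    have h3 : H (ℓ s) = hormanderIndex L₀ L₁ (A (ℓ t)) (ℓ s) :=
      hormanderIndex_eq halt (hA₀ _) (hA₁ _) (hA _) (hA₀ _) (hA₁ _) hs
    simp only [maslovPotentials] at h1 h2
    rw [h3]
    simp only [H, hormanderIndex]
    omega
  have h := LocalPotentials.sub_eq_of_eventually (g := fun t => g t - g' t - H (ℓ t)) hloc
    ⟨b, right_mem_Icc.2 hab⟩ ⟨a, left_mem_Icc.2 hab⟩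
  have hbd : ∀ L, H L ≤ 0 ∧ _ ≤ H L := fun L =>
    hormanderIndex_bounds halt hnd (hA₀ L) (hA₁ L) (hA L)
  have h1 := hbd (ℓ ⟨a, left_mem_Icc.2 hab⟩)
  have h2 := hbd (ℓ ⟨b, right_mem_Icc.2 hab⟩)
  rw [abs_le]
  constructor <;> omega

end IsMaslovIndex

theorem isMaslovIndex_maslovIndex (halt : ω.IsAlt) (hnd : ω.Nondegenerate) (L₀ : Lagrangian ω) :
    IsMaslovIndex ω L₀ (maslovIndex ω L₀) :=
  Classical.epsilon_spec (exists_isMaslovIndex halt hnd L₀)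

end Maslov

theorem proposition3p3 {V : Type*} [AddCommGroup V] [Module ℝ V] [FiniteDimensional ℝ V]
    (n : ℕ) (hn : Module.finrank ℝ V = 2 * n)
    (ω : LinearMap.BilinForm ℝ V) (hω_alt : ω.IsAlt) (hω_nondeg : ω.Nondegenerate) :
    (∀ L : Lagrangian ω, ∃! μ : LagrangianPathFunction ω, IsMaslovIndex ω L μ) ∧
    ∀ (a b : ℝ) (hab : a ≤ b) (ℓ : C(Set.Icc a b, Lagrangian ω)) (L₀ L₁ : Lagrangian ω),
      |maslovIndex ω L₀ a b hab ℓ - maslovIndex ω L₁ a b hab ℓ| ≤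
        (n : ℤ) - (Module.finrank ℝ (L₀.space ⊓ L₁.space : Submodule ℝ V) : ℤ) := by
  refine ⟨IsMaslovIndex.existsUnique hω_alt hω_nondeg, fun a b hab ℓ L₀ L₁ => ?_⟩
  rw [← Lagrangian.finrank_eq_of_finrank_eq_two_mul hn L₀]
  exact IsMaslovIndex.abs_sub_le hω_alt hω_nondeg (isMaslovIndex_maslovIndex hω_alt hω_nondeg L₀)
    (isMaslovIndex_maslovIndex hω_alt hω_nondeg L₁) hab ℓ
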